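/- Let $S$ be a finite set and let $\mathcal M(S\times S)$ be the set of $\nu:S\times S\to[0,\infty)$ with $\sum_{i,j}\nu(i,j)=1$ and $\nu(k,*):=\sum_j\nu(k,j)=\sum_i\nu(i,k)$ for all $k\in S$. Put $\nu(j|i):=\nu(i,j)/\nu(i,*)$ if $\nu(i,*)>0$, and $\nu(j|i):=0$ for all $j$ otherwise; $S_\nu:=\{k:\nu(k,*)>0\}$. Write $\nu\preceq\theta$ if $\theta(i,j)=0$ implies $\nu(i,j)=0$ for all $i,j$. The relative entropy rate is $D(\nu\|\theta):=\sum_{i,j\in S_\nu}\nu(i,j)\log\frac{\nu(j|i)}{\theta(j|i)}$ if $\nu\preceq\theta$, with terms having $\nu(i,j)=0$ read as $0$, and $D(\nu\|\theta):=\infty$ otherwise. Let $\nu_n(i_1,\dots,i_n):=\nu(i_1,*)\prod_{k=1}^{n-1}\nu(i_{k+1}|i_k)$ be the law on $S^n$ of the stationary Markov chain defined by $\nu$. For probability mass functions $P,Q$ on a finite set and $\alpha>0$, $\alpha\ne1$, let $R_\alpha(P\|Q):=\infty$ if $\alpha>1$ and $P$ is not absolutely continuous with respect to $Q$, and $R_\alpha(P\|Q):=\frac1{\alpha(\alpha-1)}\log\sum_{x:P(x)Q(x)>0}\left(\frac{P(x)}{Q(x)}\right)^{\alpha}Q(x)$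 otherwise (with $\log 0=-\infty$); for $\alpha<0$ let $R_\alpha(P\|Q):=R_{1-\alpha}(Q\|P)$. Let $\alpha\in\mathbb R\setminus\{0,1\}$ and $\nu,\theta\in\mathcal M(S\times S)$. Then the Rényi divergence rate $R_\alpha(\nu\|\theta):=\lim_{n\to\infty}\frac1n R_\alpha(\nu_n\|\theta_n)$ exists in $[-\infty,\infty]$, and the following hold, where $\mu$ ranges over $\mathcal M(S\times S)$ and $\inf\emptyset=\infty$. 1. If $\alpha>1$, then $R_\alpha(\nu\|\theta)=\sup_{\mu\preceq\nu}\left(\frac1\alpha D(\mu\|\theta)-\frac1{\alpha-1}D(\mu\|\nu)\right)$. 2. If $0<\alpha<1$, then $R_\alpha(\nu\|\theta)=\inf_{\mu\preceq\nu,\ \mu\preceq\theta}\left(\frac1\alpha D(\mu\|\theta)-\frac1{\alpha-1}D(\mu\|\nu)\right)$. 3. If $\alpha<0$, then $R_\alpha(\nu\|\theta)=\sup_{\mu\preceq\theta}\left(\frac1\alpha D(\mu\|\theta)-\frac1{\alpha-1}D(\mu\|\nu)\right)$. In all three cases the extremum is attained by some $\mu$ in the indicated set, except when $0<\alpha<1$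 and there is no $\mu\in\mathcal M(S\times S)$ with $\mu\preceq\nu$ and $\mu\preceq\theta$. Moreover, if $\alpha>1$ and $\nu\preceq\theta$, or $0<\alpha<1$ and some $\mu$ satisfies $\mu\preceq\nu$ and $\mu\preceq\theta$, or $\alpha<0$ and $\theta\preceq\nu$, then an optimizer can be chosen of the following form. Let $m(i,j):=\nu(j|i)^\alpha\theta(j|i)^{1-\alpha}$ (read as $0$ if $\nu(j|i)=0$ or $\theta(j|i)=0$). There are a set $C\subseteq S$ such that the restriction of $m$ to $C\times C$ is irreducible, and vectors $u,w:S\to[0,\infty)$, zero off $C$ and strictly positive on $C$, which restrict to a left and a right (Perron–Frobenius) eigenvector of this restriction of $m$ for the same eigenvalue $r>0$, such that $\mu(i,j)=\frac1Z u(i)\,m(i,j)\,w(j)$ for all $i,j\in S$, with $Z=\sum_{i,j}u(i)\,m(i,j)\,w(j)$. -/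

import Mathlib

open Filter Topology

/-- The Rényi divergence of order `α > 0`, `α ≠ 1`, between two probability mass functions `P`, `Q`
on a finite set; the value is `∞` when `α > 1` and `P` is not absolutely continuous with respect to
`Q`. Here `ENNReal.log 0 = -∞`, so for `0 < α < 1` and disjoint supports the value is `∞`. -/
noncomputable def renyiDivPos {Ω : Type*} [Fintype Ω] (α : ℝ) (P Q : Ω → ℝ) : EReal :=
  open Classical in
  if 1 < α ∧ ¬ (∀ x, Q x = 0 → P x = 0) then ⊤
  else ((1 / (α * (α - 1)) : ℝ) : EReal) *
    ENNReal.log (ENNReal.ofReal (∑ x with 0 < P x * Q x, (P x / Q x) ^ α * Q x))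

/-- The Rényi divergence of order `α ∈ ℝ \ {0, 1}` between two probability mass functions on a
finite set; for `α < 0` it is `R_{1 - α}(Q ‖ P)`. -/
noncomputable def renyiDiv {Ω : Type*} [Fintype Ω] (α : ℝ) (P Q : Ω → ℝ) : EReal :=
  if α < 0 then renyiDivPos (1 - α) Q P else renyiDivPos α P Q

/-- The set `M(S × S)` of Markov probability distributions: probability mass functions on `S × S`
whose two marginals agree. -/
@[ext]
structure MarkovDist (S : Type*) [Fintype S] where
  /-- the mass of the pair `(i, j)` -/
  prob : S → S → ℝ
  prob_nonneg : ∀ i j, 0 ≤ prob i j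
  sum_prob : ∑ i, ∑ j, prob i j = 1
  marginal_eq : ∀ k, ∑ j, prob k j = ∑ i, prob i k

namespace MarkovDist

variable {S : Type*} [Fintype S]

/-- The marginal `ν(k, *)`. -/
def marginal (ν : MarkovDist S) (k : S) : ℝ := ∑ j, ν.prob k j

/-- The transition probability `ν(j | i)`, equal to `0` for all `j` if `ν(i, *) = 0`. -/
noncomputable def trans (ν : MarkovDist S) (i j : S) : ℝ :=
  if 0 < ν.marginal i then ν.prob i j / ν.marginal i else 0

/-- Absolute continuity `ν ⪯ θ`. -/
def AbsCont (ν θ : MarkovDist S) : Prop := ∀ i j, θ.prob i j = 0 → ν.prob i j = 0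

/-- The support `S_ν`. -/
noncomputable def support (ν : MarkovDist S) : Finset S := {k | 0 < ν.marginal k}

/-- The relative entropy (rate) `D(ν ‖ θ)`. -/
noncomputable def relEnt (ν θ : MarkovDist S) : EReal :=
  open Classical in
  if ν.AbsCont θ then
    ((∑ i ∈ ν.support, ∑ j ∈ ν.support,
      ν.prob i j * Real.log (ν.trans i j / θ.trans i j) : ℝ) : EReal)
  else ⊤

/-- The law of the first `n + 1` states of the stationary Markov chain defined by `ν`. -/
noncomputable def pathLaw (ν : MarkovDist S) (n : ℕ) (x : Fin (n + 1) → S) : ℝ :=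
  ν.marginal (x 0) * ∏ k : Fin n, ν.trans (x k.castSucc) (x k.succ)

/-- `1/N` times the Rényi divergence between the laws of the first `N = n + 1` states. -/
noncomputable def renyiPerStep (α : ℝ) (ν θ : MarkovDist S) (n : ℕ) : EReal :=
  ((1 / ((n : ℝ) + 1) : ℝ) : EReal) * renyiDiv α (ν.pathLaw n) (θ.pathLaw n)

/-- The Rényi divergence rate `R_α(ν ‖ θ)`, the limit of `renyiPerStep`. -/
noncomputable def renyiRate (α : ℝ) (ν θ : MarkovDist S) : EReal :=
  limUnder atTop (renyiPerStep α ν θ)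

/-- The expression `(1/α) D(μ ‖ θ) - (1/(α - 1)) D(μ ‖ ν)`. -/
noncomputable def objective (α : ℝ) (ν θ μ : MarkovDist S) : EReal :=
  ((1 / α : ℝ) : EReal) * μ.relEnt θ - ((1 / (α - 1) : ℝ) : EReal) * μ.relEnt ν

/-- The matrix `[ν(j|i)^α θ(j|i)^(1-α)]`. Lean's `0 ^ x = 0` for `x ≠ 0` makes an entry with
`ν(j|i) = 0` or `θ(j|i) = 0` equal to `0`. -/
noncomputable def tiltedMatrix (α : ℝ) (ν θ : MarkovDist S) : Matrix S S ℝ :=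
  Matrix.of fun i j => ν.trans i j ^ α * θ.trans i j ^ (1 - α)

/-- `μ(i,j) = u(i) m(i,j) w(j) / Z`, where `m` is the tilted matrix, the restriction of `m` to some
set `C` of states is irreducible, `u` and `w` vanish off `C` and restrict on `C` to strictly
positive left and right (Perron–Frobenius) eigenvectors of that restriction with a common
eigenvalue `r > 0`, and `Z` is the normalization. -/
def IsPerronTilt (α : ℝ) (ν θ μ : MarkovDist S) : Prop :=
  ∃ (C : Finset S) (r : ℝ) (u w : S → ℝ),
    ((tiltedMatrix α ν θ).submatrix (Subtype.val : C → S) Subtype.val).IsIrreducible ∧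
    0 < r ∧
    (∀ i ∈ C, 0 < u i ∧ 0 < w i) ∧
    (∀ i ∉ C, u i = 0 ∧ w i = 0) ∧
    (∀ j ∈ C, ∑ i ∈ C, u i * tiltedMatrix α ν θ i j = r * u j) ∧
    (∀ i ∈ C, ∑ j ∈ C, tiltedMatrix α ν θ i j * w j = r * w i) ∧
    ∀ i j, μ.prob i j = u i * tiltedMatrix α ν θ i j * w j /
      ∑ k, ∑ l, u k * tiltedMatrix α ν θ k l * w l

end MarkovDist

/-!
For `α > 0` the sum in the Rényi divergence between the path laws is a sum over paths of products of
entries of the tilted matrix `m(i, j) = ν(j|i)^α θ(j|i)^(1-α)`, that is `a ⬝ᵥ m ^ n *ᵥ 1`. It grows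
like `r ^ n`, where `r` is the Perron root of `m`, so the rate is `log r / (α (α - 1))`, except that
it is `∞` when `α > 1` and `ν` is not absolutely continuous with respect to `θ`.

The objective at `μ` is `1 / (α (α - 1))` times the free energy `∑ μ(i, j) log (m(i, j) / μ(j|i))`,
whose maximum is `log r`. Gauging `m` by a positive vector `v` with `m v ≤ s v` gives a
substochastic matrix, and Gibbs' inequality bounds the free energy by `log s` for every `s > r`.
Equality holds for `u(i) m(i, j) w(j) / Z`, where `u` and `w` are Perron–Frobenius eigenvectors of
an irreducible block of `m` with eigenvalue `r`, which is found as a minimal set of states carrying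
a positive right eigenvector. The sign of `α (α - 1)` turns the maximum into the supremum for
`α > 1` and into the infimum for `α < 1`. Exchanging `ν` and `θ` exchanges `α` and `1 - α`, which
reduces `α < 0` to `α > 1`.
-/

section NonnegMatrix

open Matrix

variable {ι R : Type*}

section OrderedSemiring

variable [Fintype ι] [CommSemiring R] [PartialOrder R] [IsOrderedRing R] {A : Matrix ι ι R}

theorem mulVec_mono_of_nonneg (hA : ∀ i j, 0 ≤ A i j) : Monotone (A *ᵥ ·) :=
  fun _ _ hvw i => dotProduct_le_dotProduct_of_nonneg_left hvw (hA i)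

variable [DecidableEq ι]

theorem pow_mulVec_mono_of_nonneg (hA : ∀ i j, 0 ≤ A i j) (n : ℕ) : Monotone (A ^ n *ᵥ ·) := by
  induction n with
  | zero => exact fun v w hvw => by simpa only [pow_zero, one_mulVec] using hvw
  | succ n ih =>
    exact fun v w hvw => by
      simpa only [pow_succ', ← mulVec_mulVec] using mulVec_mono_of_nonneg hA (ih hvw)

theorem pow_mulVec_le_pow_smul (hA : ∀ i j, 0 ≤ A i j) {v : ι → R} {s : R} (hs : 0 ≤ s)
    (hv : A *ᵥ v ≤ s • v) (n : ℕ) : A ^ n *ᵥ v ≤ s ^ n • v := by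
  induction n with
  | zero => simp only [pow_zero, one_mulVec, one_smul, le_refl]
  | succ n ih =>
    calc A ^ (n + 1) *ᵥ v = A ^ n *ᵥ A *ᵥ v := by rw [pow_succ, mulVec_mulVec]
      _ ≤ A ^ n *ᵥ (s • v) := pow_mulVec_mono_of_nonneg hA n hv
      _ = s • A ^ n *ᵥ v := mulVec_smul _ _ _
      _ ≤ s • s ^ n • v := smul_le_smul_of_nonneg_left ih hs
      _ = s ^ (n + 1) • v := by rw [smul_smul, pow_succ']

theorem pow_smul_le_pow_mulVec (hA : ∀ i j, 0 ≤ A i j) {v : ι → R} {s : R} (hs : 0 ≤ s)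
    (hv : s • v ≤ A *ᵥ v) (n : ℕ) : s ^ n • v ≤ A ^ n *ᵥ v := by
  induction n with
  | zero => simp only [pow_zero, one_mulVec, one_smul, le_refl]
  | succ n ih =>
    calc s ^ (n + 1) • v = s • s ^ n • v := by rw [smul_smul, pow_succ']
      _ ≤ s • A ^ n *ᵥ v := smul_le_smul_of_nonneg_left ih hs
      _ = A ^ n *ᵥ (s • v) := (mulVec_smul _ _ _).symm
      _ ≤ A ^ n *ᵥ A *ᵥ v := pow_mulVec_mono_of_nonneg hA n hv
      _ = A ^ (n + 1) *ᵥ v := by rw [pow_succ, mulVec_mulVec]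

end OrderedSemiring

theorem mulVec_pos_of_pos [Fintype ι] [CommSemiring R] [PartialOrder R] [IsStrictOrderedRing R]
    {A : Matrix ι ι R} (hA : ∀ i j, 0 < A i j) {x : ι → R} (hx : 0 < x) (i : ι) :
    0 < (A *ᵥ x) i := by
  obtain ⟨hx0, j, hj⟩ := Pi.lt_def.1 hx
  exact Finset.sum_pos' (fun k _ => mul_nonneg (hA i k).le (hx0 k))
    ⟨j, Finset.mem_univ j, mul_pos (hA i j) hj⟩

theorem dotProduct_pow_mulVec_eq_sum_paths [Fintype ι] [DecidableEq ι] [CommSemiring R]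
    (A : Matrix ι ι R) (a g : ι → R) (n : ℕ) :
    a ⬝ᵥ A ^ n *ᵥ g = ∑ x : Fin (n + 1) → ι,
      a (x 0) * (∏ k : Fin n, A (x k.castSucc) (x k.succ)) * g (x (Fin.last n)) := by
  induction n generalizing g with
  | zero =>
    rw [← (Equiv.funUnique (Fin 1) ι).symm.sum_comp]
    simp [dotProduct]
  | succ n ih =>
    rw [pow_succ, ← mulVec_mulVec, ih, ← (Fin.snocEquiv fun _ : Fin (n + 2) => ι).sum_comp,
      Fintype.sum_prod_type, Finset.sum_comm]
    refine Finset.sum_congr rfl fun x _ => ?_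
    rw [mulVec, dotProduct, Finset.mul_sum]
    refine Finset.sum_congr rfl fun j _ => ?_
    have snoc_zero : (Fin.snoc x j : Fin (n + 2) → ι) 0 = x 0 :=
      Fin.snoc_castSucc (α := fun _ => ι) j x 0
    simp only [Fin.prod_univ_castSucc, Fin.snocEquiv, Equiv.coe_fn_mk, snoc_zero,
      Fin.snoc_castSucc, Fin.succ_last, Fin.snoc_last, Fin.succ_castSucc]
    ring

section RealVector

theorem exists_pos_le_smul [Finite ι] (g : ι → ℝ) {v : ι → ℝ} (hv : ∀ i, 0 < v i) :
    ∃ b > (0 : ℝ), g ≤ b • v :=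
  ((eventually_gt_atTop (0 : ℝ)).and (eventually_all.2 fun i =>
    (tendsto_id.atTop_mul_const (hv i)).eventually_ge_atTop (g i))).exists

theorem exists_gt_smul_le [Finite ι] {t : ℝ} {y z : ι → ℝ} (h : ∀ i, t * y i < z i) :
    ∃ s > t, s • y ≤ z := by
  have hlt : ∀ᶠ s in 𝓝 t, ∀ i, s * y i < z i := eventually_all.2 fun i =>
    ((continuous_mul_const (y i)).tendsto t).eventually_lt_const (h i)
  obtain ⟨s, hs, hts⟩ := ((hlt.filter_mono nhdsWithin_le_nhds).and
    (self_mem_nhdsWithin : Set.Ioi t ∈ 𝓝[>] t)).exists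
  exact ⟨s, hts, fun i => (hs i).le⟩

variable [Fintype ι]

theorem pos_of_mem_stdSimplex {x : ι → ℝ} (hx : x ∈ stdSimplex ℝ ι) : 0 < x := by
  refine lt_of_le_of_ne hx.1 ?_
  rintro rfl
  simpa using hx.2

theorem inv_sum_smul_mem_stdSimplex {x : ι → ℝ} (hx : 0 < x) :
    (∑ i, x i)⁻¹ • x ∈ stdSimplex ℝ ι := by
  have hsum : 0 < ∑ i, x i := Fintype.sum_pos hx
  refine ⟨fun i => mul_nonneg (inv_nonneg.2 hsum.le) (hx.le i), ?_⟩
  simp only [Pi.smul_apply, smul_eq_mul, ← Finset.mul_sum, inv_mul_cancel₀ hsum.ne']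

end RealVector

section PerronTheorem

variable [Fintype ι] {A : Matrix ι ι ℝ}

/-- The pairs `(t, x)` admitted in the Collatz–Wielandt variational problem: `x` is a probability
vector with `t x ≤ A x` and `t ≥ 0`. The largest such `t` is the Perron eigenvalue. -/
def collatzWielandtSet (A : Matrix ι ι ℝ) : Set (ℝ × (ι → ℝ)) :=
  {p | 0 ≤ p.1 ∧ p.2 ∈ stdSimplex ℝ ι ∧ p.1 • p.2 ≤ A *ᵥ p.2}

theorem le_sum_mulVec_of_smul_le {t : ℝ} {x : ι → ℝ} (hx : x ∈ stdSimplex ℝ ι)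
    (htx : t • x ≤ A *ᵥ x) : t ≤ ∑ i, (A *ᵥ x) i :=
  calc t = ∑ i, (t • x) i := by
        simp only [Pi.smul_apply, smul_eq_mul, ← Finset.mul_sum, hx.2, mul_one]
    _ ≤ ∑ i, (A *ᵥ x) i := Finset.sum_le_sum fun i _ => htx i

theorem isCompact_collatzWielandtSet (A : Matrix ι ι ℝ) : IsCompact (collatzWielandtSet A) := by
  obtain ⟨B, hB⟩ := (isCompact_stdSimplex ℝ ι).bddAbove_image
    (f := fun x => ∑ i, (A *ᵥ x) i) (by fun_prop)
  have hclosed : IsClosed {p : ℝ × (ι → ℝ) | p.1 • p.2 ≤ A *ᵥ p.2} :=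
    isClosed_le (by fun_prop) (by fun_prop)
  convert (isCompact_Icc (a := 0) (b := B)).prod (isCompact_stdSimplex ℝ ι) |>.inter_right hclosed
    using 1
  ext ⟨t, x⟩
  constructor
  · rintro ⟨ht, hx, htx⟩
    have htB : t ≤ B := (le_sum_mulVec_of_smul_le hx htx).trans (hB ⟨x, hx, rfl⟩)
    exact ⟨⟨⟨ht, htB⟩, hx⟩, htx⟩
  · rintro ⟨⟨⟨ht, -⟩, hx⟩, htx⟩
    exact ⟨ht, hx, htx⟩

theorem exists_gt_smul_le_mulVec (hA : ∀ i j, 0 < A i j) {t : ℝ} {x : ι → ℝ}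
    (hx : x ∈ stdSimplex ℝ ι) (htx : t • x ≤ A *ᵥ x) (hne : A *ᵥ x ≠ t • x) :
    ∃ s > t, ∃ y ∈ stdSimplex ℝ ι, s • y ≤ A *ᵥ y := by
  have defect_pos : 0 < A *ᵥ x - t • x := sub_pos.2 (lt_of_le_of_ne htx hne.symm)
  obtain ⟨s, hts, hs⟩ : ∃ s > t, s • A *ᵥ x ≤ A *ᵥ A *ᵥ x := exists_gt_smul_le fun i => by
    have h := mulVec_pos_of_pos hA defect_pos i
    rwa [mulVec_sub, mulVec_smul, Pi.sub_apply, sub_pos] at h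
  have image_pos : 0 < A *ᵥ x := by
    obtain ⟨-, i, -⟩ := Pi.lt_def.1 defect_pos
    have hAx := mulVec_pos_of_pos hA (pos_of_mem_stdSimplex hx)
    exact Pi.lt_def.2 ⟨fun k => (hAx k).le, i, hAx i⟩
  refine ⟨s, hts, _, inv_sum_smul_mem_stdSimplex image_pos, ?_⟩
  rw [mulVec_smul, smul_comm]
  exact smul_le_smul_of_nonneg_left hs (inv_nonneg.2 (Fintype.sum_pos image_pos).le)

theorem exists_pos_eigenvector_of_pos [Nonempty ι] (hA : ∀ i j, 0 < A i j) :
    ∃ (r : ℝ), ∃ w ∈ stdSimplex ℝ ι, (∀ i, 0 < w i) ∧ A *ᵥ w = r • w := by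
  classical
  let i₀ := Classical.arbitrary ι
  have hne : (collatzWielandtSet A).Nonempty := by
    refine ⟨(0, Pi.single i₀ 1), le_rfl, single_mem_stdSimplex ℝ i₀, ?_⟩
    rw [zero_smul]
    exact fun i => (mulVec_pos_of_pos hA (Pi.single_pos.2 one_pos) i).le
  obtain ⟨⟨r, w⟩, ⟨hr, hw, hrw⟩, hmax⟩ :=
    (isCompact_collatzWielandtSet A).exists_isMaxOn hne continuousOn_fst
  have heigen : A *ᵥ w = r • w := by
    by_contra hne
    obtain ⟨s, hrs, y, hy, hsy⟩ := exists_gt_smul_le_mulVec hA hw hrw hne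
    exact (hmax (show (s, y) ∈ collatzWielandtSet A from ⟨hr.trans hrs.le, hy, hsy⟩)).not_gt hrs
  refine ⟨r, w, hw, fun i => ?_, heigen⟩
  have hpos := mulVec_pos_of_pos hA (pos_of_mem_stdSimplex hw) i
  rw [heigen] at hpos
  exact pos_of_mul_pos_right hpos hr

/-- `A` has an `s`-subinvariant vector in the sense of Seneta, that is `A v ≤ s v`, with positive
entries. It certifies that `s` is an upper bound for the spectral radius of a nonnegative `A`. -/
def HasPosSubinvariantVector (A : Matrix ι ι ℝ) (s : ℝ) : Prop :=
  ∃ v : ι → ℝ, (∀ i, 0 < v i) ∧ A *ᵥ v ≤ s • v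

theorem exists_pos_eigenvector_perturbed [Nonempty ι] (hA : ∀ i j, 0 ≤ A i j) {ε : ℝ}
    (hε : 0 < ε) :
    ∃ (r : ℝ), ∃ w ∈ stdSimplex ℝ ι, (∀ i, 0 < w i) ∧ A *ᵥ w + ε • 1 = r • w := by
  obtain ⟨r, w, hw, hpos, heigen⟩ := exists_pos_eigenvector_of_pos
    (A := A + of fun _ _ => ε) fun i j => add_pos_of_nonneg_of_pos (hA i j) hε
  refine ⟨r, w, hw, hpos, ?_⟩
  rw [← heigen, add_mulVec]
  congr 1
  ext i
  simp only [Pi.smul_apply, Pi.one_apply, smul_eq_mul, mul_one, mulVec, dotProduct, of_apply,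
    ← Finset.mul_sum, hw.2]

theorem exists_nonneg_eigenvector [Nonempty ι] (hA : ∀ i j, 0 ≤ A i j) :
    ∃ r ≥ 0, (∃ w ∈ stdSimplex ℝ ι, A *ᵥ w = r • w) ∧
      ∀ s > r, HasPosSubinvariantVector A s := by
  choose ρ w hwmem hwpos heigen using fun n : ℕ =>
    exists_pos_eigenvector_perturbed hA (Nat.one_div_pos_of_nat (α := ℝ) (n := n))
  obtain ⟨x, hx, φ, hφ, hlim⟩ := (isCompact_stdSimplex ℝ ι).tendsto_subseq hwmem
  have hlim' : Tendsto (fun n => A *ᵥ w (φ n) + (1 / ((φ n : ℝ) + 1)) • (1 : ι → ℝ)) atTop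
      (𝓝 (A *ᵥ x)) := by
    have hε := tendsto_one_div_add_atTop_nhds_zero_nat (𝕜 := ℝ) |>.comp hφ.tendsto_atTop
    have hcont : Continuous fun y : ι → ℝ => A *ᵥ y := by fun_prop
    simpa only [zero_smul, add_zero, Function.comp_apply] using
      ((hcont.tendsto x).comp hlim).add (hε.smul_const (1 : ι → ℝ))
  simp only [heigen] at hlim'
  have hρlim : Tendsto (fun n => ρ (φ n)) atTop (𝓝 (∑ i, (A *ᵥ x) i)) := by
    refine (tendsto_finsetSum Finset.univ fun i _ => (tendsto_pi_nhds.1 hlim' i)).congr fun n => ?_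
    simp only [Pi.smul_apply, smul_eq_mul, ← Finset.mul_sum, (hwmem _).2, mul_one]
  refine ⟨_, Finset.sum_nonneg fun i _ => dotProduct_nonneg_of_nonneg (hA i) hx.1,
    ⟨x, hx, tendsto_nhds_unique hlim' (hρlim.smul hlim)⟩, fun s hs => ?_⟩
  obtain ⟨n, hn⟩ := (hρlim.eventually_lt_const hs).exists
  refine ⟨w (φ n), hwpos _, ?_⟩
  calc A *ᵥ w (φ n) ≤ ρ (φ n) • w (φ n) := by
        rw [← heigen]
        exact le_add_of_nonneg_right (smul_nonneg Nat.one_div_pos_of_nat.le zero_le_one)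
    _ ≤ s • w (φ n) := smul_le_smul_of_nonneg_right hn.le fun i => (hwpos _ i).le

end PerronTheorem

section Irreducible

variable [Ring R] [LinearOrder R] {A : Matrix ι ι R}

theorem eq_univ_of_isIrreducible (hA : A.IsIrreducible) {K : Set ι} (hK : K.Nonempty)
    (hclosed : ∀ i ∈ K, ∀ j, 0 < A i j → j ∈ K) : K = Set.univ := by
  let : Quiver ι := toQuiver A
  obtain ⟨i, hi⟩ := hK
  have mem_of_path {j : ι} (p : Quiver.Path i j) : j ∈ K := by
    induction p with
    | nil => exact hi
    | cons _ e ih => exact hclosed _ ih _ e.down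
  refine Set.eq_univ_of_forall fun j => ?_
  obtain ⟨p, -⟩ := hA.connected i j
  exact mem_of_path p

theorem isIrreducible_of_forall_eq_univ (hA : ∀ i j, 0 ≤ A i j) (hrow : ∀ i, ∃ j, 0 < A i j)
    (hclosed : ∀ K : Set ι, K.Nonempty → (∀ i ∈ K, ∀ j, 0 < A i j → j ∈ K) → K = Set.univ) :
    A.IsIrreducible := by
  let : Quiver ι := toQuiver A
  refine ⟨hA, fun i j => ?_⟩
  have hreach : {k | ∃ p : Quiver.Path i k, 0 < p.length} = Set.univ := by
    refine hclosed _ ?_ ?_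
    · obtain ⟨k, hk⟩ := hrow i
      exact ⟨k, Quiver.Path.nil.cons ⟨hk⟩, Nat.succ_pos _⟩
    · rintro k ⟨p, -⟩ l hkl
      exact ⟨p.cons ⟨hkl⟩, Nat.succ_pos _⟩
  exact hreach.ge (Set.mem_univ j)

end Irreducible

section PerronClass

variable {A : Matrix ι ι ℝ} {r : ℝ}

/-- The principal submatrix of `A` on the nonempty set `C` has an eigenvector with positive entries
for the eigenvalue `r`. The sets `C` minimal with this property carry the irreducible blocks of `A`
with Perron eigenvalue `r`. -/
def HasPosEigenvectorOn (A : Matrix ι ι ℝ) (r : ℝ) (C : Finset ι) : Prop :=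
  C.Nonempty ∧ ∃ w : ι → ℝ, (∀ i ∈ C, 0 < w i) ∧ ∀ i ∈ C, ∑ j ∈ C, A i j * w j = r * w i

theorem isIrreducible_submatrix_of_minimal (hA : ∀ i j, 0 ≤ A i j) (hr : 0 < r) {C : Finset ι}
    (hC : Minimal (HasPosEigenvectorOn A r) C) :
    (A.submatrix (Subtype.val : C → ι) Subtype.val).IsIrreducible := by
  classical
  obtain ⟨⟨-, w, hw, hAw⟩, hmin⟩ := hC
  refine isIrreducible_of_forall_eq_univ (fun i j => hA i j) (fun i => ?_) fun K hK hclosed => ?_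
  · obtain ⟨j, hj, hij⟩ : ∃ j ∈ C, A i j * w j ≠ 0 := by
      refine Finset.exists_ne_zero_of_sum_ne_zero ?_
      rw [hAw i i.2]
      exact (mul_pos hr (hw i i.2)).ne'
    exact ⟨⟨j, hj⟩, lt_of_le_of_ne (hA i j) (left_ne_zero_of_mul hij).symm⟩
  · let K' : Finset ι := {i ∈ C | i ∈ Subtype.val '' K}
    have hK' : HasPosEigenvectorOn A r K' := by
      obtain ⟨k, hk⟩ := hK
      refine ⟨⟨k, Finset.mem_filter.2 ⟨k.2, k, hk, rfl⟩⟩, w,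
        fun i hi => hw i (Finset.filter_subset _ C hi), fun i hi => ?_⟩
      obtain ⟨hiC, i', hi', rfl⟩ := Finset.mem_filter.1 hi
      rw [← hAw i' hiC]
      refine Finset.sum_subset (Finset.filter_subset _ C) fun j hjC hjK => ?_
      have hij : ¬ 0 < A i' j := fun h => hjK <|
        Finset.mem_filter.2 ⟨hjC, ⟨j, hjC⟩, hclosed i' hi' ⟨j, hjC⟩ h, rfl⟩
      rw [le_antisymm (not_lt.1 hij) (hA _ j), zero_mul]
    refine Set.eq_univ_of_forall fun j => ?_
    obtain ⟨-, j', hj', hjj'⟩ := Finset.mem_filter.1 (hmin hK' (Finset.filter_subset _ C) j.2)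
    exact Subtype.ext hjj' ▸ hj'

variable [Fintype ι]

theorem exists_hasPosEigenvectorOn {w : ι → ℝ} (hw : 0 < w) (hAw : A *ᵥ w = r • w) :
    ∃ C, HasPosEigenvectorOn A r C := by
  classical
  obtain ⟨hw0, k, hk⟩ := Pi.lt_def.1 hw
  refine ⟨({i | 0 < w i} : Finset ι), ⟨k, Finset.mem_filter_univ k |>.2 hk⟩, w,
    fun i hi => (Finset.mem_filter_univ i).1 hi, fun i _ => ?_⟩
  calc ∑ j with 0 < w j, A i j * w j = (A *ᵥ w) i :=
        Finset.sum_filter_of_ne fun j _ hj =>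
          lt_of_le_of_ne (hw0 j) (right_ne_zero_of_mul hj).symm
    _ = r * w i := congrFun hAw i

theorem exists_pos_left_eigenvector_of_isIrreducible [Nonempty ι] (hA : A.IsIrreducible)
    {w : ι → ℝ} (hw : ∀ i, 0 < w i) (hAw : A *ᵥ w = r • w) :
    ∃ u : ι → ℝ, (∀ i, 0 < u i) ∧ u ᵥ* A = r • u := by
  obtain ⟨r', hr', ⟨u, hu, huA⟩, -⟩ := exists_nonneg_eigenvector (A := Aᵀ) fun i j => hA.nonneg j i
  rw [mulVec_transpose] at huA
  obtain ⟨-, k, hk⟩ := Pi.lt_def.1 (pos_of_mem_stdSimplex hu)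
  obtain rfl : r' = r := by
    have huw : 0 < u ⬝ᵥ w := Finset.sum_pos' (fun i _ => mul_nonneg (hu.1 i) (hw i).le)
      ⟨k, Finset.mem_univ k, mul_pos hk (hw k)⟩
    refine mul_right_cancel₀ huw.ne' ?_
    calc r' * u ⬝ᵥ w = u ᵥ* A ⬝ᵥ w := by rw [huA, smul_dotProduct, smul_eq_mul]
      _ = r * u ⬝ᵥ w := by rw [← dotProduct_mulVec, hAw, dotProduct_smul, smul_eq_mul]
  have hsupp : {i | 0 < u i} = Set.univ := by
    refine eq_univ_of_isIrreducible hA ⟨k, hk⟩ fun i hi j hij => ?_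
    have hpos : 0 < (u ᵥ* A) j := Finset.sum_pos'
      (fun l _ => mul_nonneg (hu.1 l) (hA.nonneg l j)) ⟨i, Finset.mem_univ i, mul_pos hi hij⟩
    rw [huA] at hpos
    exact pos_of_mul_pos_right hpos hr'
  exact ⟨u, fun i => hsupp.ge (Set.mem_univ i), huA⟩

/-- `C` is a set of states on which `A` is irreducible, and `u`, `w` are left and right
Perron–Frobenius eigenvectors of the restriction of `A` to `C` for the eigenvalue `r`, extended
by `0`. -/
structure IsPerronClass (A : Matrix ι ι ℝ) (r : ℝ) (C : Finset ι) (u w : ι → ℝ) : Prop where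
  nonempty : C.Nonempty
  isIrreducible : (A.submatrix (Subtype.val : C → ι) Subtype.val).IsIrreducible
  pos : ∀ i ∈ C, 0 < u i ∧ 0 < w i
  eq_zero : ∀ i ∉ C, u i = 0 ∧ w i = 0
  left_eigen : ∀ j ∈ C, ∑ i ∈ C, u i * A i j = r * u j
  right_eigen : ∀ i ∈ C, ∑ j ∈ C, A i j * w j = r * w i

theorem exists_isPerronClass (hA : ∀ i j, 0 ≤ A i j) (hr : 0 < r) {x : ι → ℝ} (hx : 0 < x)
    (hAx : A *ᵥ x = r • x) : ∃ C u w, IsPerronClass A r C u w := by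
  classical
  obtain ⟨C, hC⟩ := exists_minimal_of_wellFoundedLT (HasPosEigenvectorOn A r)
    (exists_hasPosEigenvectorOn hx hAx)
  have hirr := isIrreducible_submatrix_of_minimal hA hr hC
  obtain ⟨⟨hne, w, hw, hAw⟩, -⟩ := hC
  have : Nonempty C := hne.to_subtype
  obtain ⟨u, hu, huA⟩ := exists_pos_left_eigenvector_of_isIrreducible (r := r) hirr
    (w := fun i : C => w i) (fun i => hw i i.2) <| funext fun i =>
      (Finset.sum_coe_sort C fun j => A i j * w j).trans (hAw i i.2)
  refine ⟨C, fun i => if h : i ∈ C then u ⟨i, h⟩ else 0, fun i => if i ∈ C then w i else 0, hne,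
    hirr, fun i hi => ?_, fun i hi => ?_, fun j hj => ?_, fun i hi => ?_⟩
  · simp only [hi, dite_true, if_true, hu, hw i hi, and_self]
  · simp only [hi, dite_false, if_false, and_self]
  · rw [← Finset.sum_coe_sort]
    simpa [hj, vecMul, dotProduct] using congrFun huA ⟨j, hj⟩
  · rw [if_pos hi, ← hAw i hi]
    exact Finset.sum_congr rfl fun j hj => by rw [if_pos hj]

end PerronClass

end NonnegMatrix

section Growth

theorem log_le_expGrowthInf_of_geometric_le {Z : ℕ → ℝ} {b r : ℝ} (hb : 0 < b) (hr : 0 < r)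
    (h : ∀ n, b * r ^ n ≤ Z n) :
    ENNReal.log (ENNReal.ofReal r) ≤
      ExpGrowth.expGrowthInf fun n => ENNReal.ofReal (Z (n - 1)) := by
  rw [← ExpGrowth.expGrowthInf_pow]
  refine ExpGrowth.expGrowthInf_of_eventually_ge (b := ENNReal.ofReal (b / r))
    (ENNReal.ofReal_pos.2 (div_pos hb hr)).ne' ((eventually_ge_atTop 1).mono fun n hn => ?_)
  rw [← ENNReal.ofReal_pow hr.le, ← ENNReal.ofReal_mul (div_pos hb hr).le]
  refine ENNReal.ofReal_le_ofReal ((h (n - 1)).trans_eq' ?_)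
  rw [← mul_pow_sub_one (Nat.one_le_iff_ne_zero.1 hn), ← mul_assoc, div_mul_cancel₀ b hr.ne']

theorem expGrowthSup_le_log_of_le_geometric {Z : ℕ → ℝ} {b s : ℝ} (hs : 0 < s)
    (h : ∀ n, Z n ≤ b * s ^ n) :
    ExpGrowth.expGrowthSup (fun n => ENNReal.ofReal (Z (n - 1))) ≤
      ENNReal.log (ENNReal.ofReal s) := by
  rw [← ExpGrowth.expGrowthSup_pow]
  refine ExpGrowth.expGrowthSup_le_of_eventually_le (b := ENNReal.ofReal (b / s))
    ENNReal.ofReal_ne_top ((eventually_ge_atTop 1).mono fun n hn => ?_)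
  rw [← ENNReal.ofReal_pow hs.le, ← ENNReal.ofReal_mul' (pow_pos hs n).le]
  refine ENNReal.ofReal_le_ofReal ((h (n - 1)).trans_eq ?_)
  rw [← mul_pow_sub_one (Nat.one_le_iff_ne_zero.1 hn), ← mul_assoc, div_mul_cancel₀ b hs.ne']

theorem tendsto_log_div_of_geometric_bounds {Z : ℕ → ℝ} {r : ℝ} (hr : 0 ≤ r)
    (lower : 0 < r → ∃ b > 0, ∀ n, b * r ^ n ≤ Z n) (upper : ∀ s > r, ∃ b, ∀ n, Z n ≤ b * s ^ n) :
    Tendsto (fun n : ℕ => ((1 / ((n : ℝ) + 1) : ℝ) : EReal) * ENNReal.log (ENNReal.ofReal (Z n)))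
      atTop (𝓝 (ENNReal.log (ENNReal.ofReal r))) := by
  let u (n : ℕ) : ENNReal := ENNReal.ofReal (Z (n - 1))
  have le_inf : ENNReal.log (ENNReal.ofReal r) ≤ ExpGrowth.expGrowthInf u := by
    obtain rfl | hr := hr.eq_or_lt
    · simp only [ENNReal.ofReal_zero, ENNReal.log_zero, bot_le]
    · obtain ⟨b, hb, hZ⟩ := lower hr
      exact log_le_expGrowthInf_of_geometric_le hb hr hZ
  have sup_le : ExpGrowth.expGrowthSup u ≤ ENNReal.log (ENNReal.ofReal r) := by
    refine EReal.le_of_forall_lt_iff_le.1 fun z hz => ?_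
    have log_ofReal_exp : ENNReal.log (ENNReal.ofReal (Real.exp z)) = z := by
      rw [ENNReal.log_ofReal_of_pos (Real.exp_pos z), Real.log_exp]
    have hrz : r < Real.exp z := by
      rwa [← ENNReal.ofReal_lt_ofReal_iff (Real.exp_pos z), ← ENNReal.log_lt_log_iff,
        log_ofReal_exp]
    obtain ⟨b, hZ⟩ := upper _ hrz
    exact (expGrowthSup_le_log_of_le_geometric (Real.exp_pos z) hZ).trans_eq log_ofReal_exp
  have inf_le := ExpGrowth.expGrowthInf_le_expGrowthSup (u := u)
  have hlim := tendsto_of_liminf_eq_limsup (f := atTop) (u := fun n : ℕ => ENNReal.log (u n) / n)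
    (le_antisymm (inf_le.trans sup_le) le_inf) (le_antisymm sup_le (le_inf.trans inf_le))
  refine (hlim.comp (tendsto_add_atTop_nat 1)).congr fun n => ?_
  simp only [Function.comp_apply, u, Nat.add_sub_cancel, EReal.div_eq_inv_mul, one_div]
  congr 1
  norm_cast

end Growth

section PerronRoot

open Matrix

variable {ι : Type*} {A : Matrix ι ι ℝ} {r : ℝ} {C : Finset ι} {u w : ι → ℝ}

namespace IsPerronClass

theorem transpose (h : IsPerronClass A r C u w) : IsPerronClass Aᵀ r C w u where
  nonempty := h.nonempty
  isIrreducible := h.isIrreducible.transpose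
  pos i hi := (h.pos i hi).symm
  eq_zero i hi := (h.eq_zero i hi).symm
  left_eigen j hj := by simpa only [transpose_apply, mul_comm] using h.right_eigen j hj
  right_eigen i hi := by simpa only [transpose_apply, mul_comm] using h.left_eigen i hi

theorem right_nonneg (h : IsPerronClass A r C u w) (i : ι) : 0 ≤ w i := by
  by_cases hi : i ∈ C
  · exact (h.pos i hi).2.le
  · exact (h.eq_zero i hi).2.ge

theorem exists_pos_entry (h : IsPerronClass A r C u w) (hA : ∀ i j, 0 ≤ A i j) (hr : 0 < r) :
    ∃ i ∈ C, ∃ j, 0 < A i j := by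
  obtain ⟨i, hi⟩ := h.nonempty
  obtain ⟨j, -, hij⟩ := Finset.exists_ne_zero_of_sum_ne_zero
    ((h.right_eigen i hi).trans_ne (mul_pos hr (h.pos i hi).2).ne')
  exact ⟨i, hi, j, lt_of_le_of_ne (hA i j) (left_ne_zero_of_mul hij).symm⟩

variable [Fintype ι]

theorem mulVec_apply_of_mem (h : IsPerronClass A r C u w) {i : ι} (hi : i ∈ C) :
    (A *ᵥ w) i = r * w i := by
  rw [← h.right_eigen i hi]
  exact (Finset.sum_subset C.subset_univ fun j _ hj => by rw [(h.eq_zero j hj).2, mul_zero]).symm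

theorem smul_le_mulVec (h : IsPerronClass A r C u w) (hA : ∀ i j, 0 ≤ A i j) :
    r • w ≤ A *ᵥ w := fun i => by
  by_cases hi : i ∈ C
  · exact (h.mulVec_apply_of_mem hi).ge
  · rw [Pi.smul_apply, (h.eq_zero i hi).2, smul_zero]
    exact dotProduct_nonneg_of_nonneg (hA i) h.right_nonneg

theorem sum_right (h : IsPerronClass A r C u w) (i : ι) :
    ∑ j, u i * A i j * w j = r * (u i * w i) := by
  simp only [mul_assoc, ← Finset.mul_sum]
  by_cases hi : i ∈ C
  · rw [mul_left_comm]
    exact congrArg (u i * ·) (h.mulVec_apply_of_mem hi)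
  · simp only [(h.eq_zero i hi).1, zero_mul, mul_zero]

theorem sum_left (h : IsPerronClass A r C u w) (j : ι) :
    ∑ i, u i * A i j * w j = r * (u j * w j) := by
  simpa only [transpose_apply, mul_comm, mul_left_comm] using h.transpose.sum_right j

theorem sum_sum_pos (h : IsPerronClass A r C u w) (hr : 0 < r) :
    0 < ∑ i, ∑ j, u i * A i j * w j := by
  simp only [h.sum_right, ← Finset.mul_sum]
  obtain ⟨i, hi⟩ := h.nonempty
  exact mul_pos hr <| Finset.sum_pos'
    (fun k _ => mul_nonneg (h.transpose.right_nonneg k) (h.right_nonneg k))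
    ⟨i, Finset.mem_univ i, mul_pos (h.pos i hi).1 (h.pos i hi).2⟩

end IsPerronClass

variable [Fintype ι]

/-- `r` is the Perron root of the nonnegative matrix `A`, that is its spectral radius, described by
the two properties through which it is used: numbers above `r` have positive subinvariant vectors,
and `r` is the eigenvalue of an irreducible block of `A`. There need not be such a block when
`r = 0`, the case of a nilpotent `A`. -/
structure IsPerronRoot (A : Matrix ι ι ℝ) (r : ℝ) : Prop where
  nonneg : 0 ≤ r
  hasPosSubinvariantVector : ∀ s > r, HasPosSubinvariantVector A s
  exists_isPerronClass : 0 < r → ∃ C u w, IsPerronClass A r C u w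

theorem exists_isPerronRoot [Nonempty ι] (hA : ∀ i j, 0 ≤ A i j) : ∃ r, IsPerronRoot A r := by
  obtain ⟨r, hr, ⟨x, hx, hAx⟩, hsub⟩ := exists_nonneg_eigenvector hA
  exact ⟨r, hr, hsub, fun hr => exists_isPerronClass hA hr (pos_of_mem_stdSimplex hx) hAx⟩

namespace IsPerronRoot

variable [DecidableEq ι] {a : ι → ℝ}

theorem exists_dotProduct_pow_mulVec_one_le (h : IsPerronRoot A r) (hA : ∀ i j, 0 ≤ A i j)
    (ha : 0 ≤ a) {s : ℝ} (hs : r < s) : ∃ b, ∀ n, a ⬝ᵥ A ^ n *ᵥ 1 ≤ b * s ^ n := by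
  obtain ⟨v, hv, hAv⟩ := h.hasPosSubinvariantVector s hs
  obtain ⟨b, hb, hbv⟩ := exists_pos_le_smul 1 hv
  refine ⟨b * a ⬝ᵥ v, fun n => ?_⟩
  calc a ⬝ᵥ A ^ n *ᵥ 1 ≤ a ⬝ᵥ A ^ n *ᵥ (b • v) :=
        dotProduct_le_dotProduct_of_nonneg_left (pow_mulVec_mono_of_nonneg hA n hbv) ha
    _ = b * a ⬝ᵥ A ^ n *ᵥ v := by rw [mulVec_smul, dotProduct_smul, smul_eq_mul]
    _ ≤ b * a ⬝ᵥ s ^ n • v :=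
        mul_le_mul_of_nonneg_left (dotProduct_le_dotProduct_of_nonneg_left
          (pow_mulVec_le_pow_smul hA (h.nonneg.trans hs.le) hAv n) ha) hb.le
    _ = b * a ⬝ᵥ v * s ^ n := by rw [dotProduct_smul, smul_eq_mul, mul_comm (s ^ n), mul_assoc]

theorem exists_le_dotProduct_pow_mulVec_one (h : IsPerronRoot A r) (hA : ∀ i j, 0 ≤ A i j)
    (ha : 0 ≤ a) (hpos : ∀ i j, 0 < A i j → 0 < a i) (hr : 0 < r) :
    ∃ b > 0, ∀ n, b * r ^ n ≤ a ⬝ᵥ A ^ n *ᵥ 1 := by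
  obtain ⟨C, u, w, hC⟩ := h.exists_isPerronClass hr
  obtain ⟨b, hb, hbw⟩ := exists_pos_le_smul w (v := 1) fun _ => one_pos
  have haw : 0 < a ⬝ᵥ w := by
    obtain ⟨i, hi, j, hij⟩ := hC.exists_pos_entry hA hr
    exact Finset.sum_pos' (fun k _ => mul_nonneg (ha k) (hC.right_nonneg k))
      ⟨i, Finset.mem_univ i, mul_pos (hpos i j hij) (hC.pos i hi).2⟩
  refine ⟨a ⬝ᵥ w / b, div_pos haw hb, fun n => ?_⟩
  rw [div_mul_eq_mul_div, div_le_iff₀ hb]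
  calc a ⬝ᵥ w * r ^ n = a ⬝ᵥ r ^ n • w := by rw [dotProduct_smul, smul_eq_mul, mul_comm]
    _ ≤ a ⬝ᵥ A ^ n *ᵥ w := dotProduct_le_dotProduct_of_nonneg_left
        (pow_smul_le_pow_mulVec hA hr.le (hC.smul_le_mulVec hA) n) ha
    _ ≤ a ⬝ᵥ A ^ n *ᵥ (b • 1) :=
        dotProduct_le_dotProduct_of_nonneg_left (pow_mulVec_mono_of_nonneg hA n hbw) ha
    _ = a ⬝ᵥ A ^ n *ᵥ 1 * b := by rw [mulVec_smul, dotProduct_smul, smul_eq_mul, mul_comm]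

theorem tendsto_log_dotProduct_pow_mulVec_one (h : IsPerronRoot A r) (hA : ∀ i j, 0 ≤ A i j)
    (ha : 0 ≤ a) (hpos : ∀ i j, 0 < A i j → 0 < a i) :
    Tendsto (fun n : ℕ => ((1 / ((n : ℝ) + 1) : ℝ) : EReal) *
      ENNReal.log (ENNReal.ofReal (a ⬝ᵥ A ^ n *ᵥ 1))) atTop
      (𝓝 (ENNReal.log (ENNReal.ofReal r))) :=
  tendsto_log_div_of_geometric_bounds h.nonneg (h.exists_le_dotProduct_pow_mulVec_one hA ha hpos)
    fun _ hs => h.exists_dotProduct_pow_mulVec_one_le hA ha hs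

end IsPerronRoot

end PerronRoot

section RenyiDivergence

variable {Ω : Type*} [Fintype Ω] {α : ℝ} {P Q : Ω → ℝ}

theorem renyiDiv_one_sub_of_neg (hα : α < 0) (P Q : Ω → ℝ) :
    renyiDiv (1 - α) Q P = renyiDiv α P Q := by
  rw [renyiDiv, renyiDiv, if_pos hα, if_neg (by linarith)]

theorem renyiDivPos_eq_top (hα : 1 < α) {x : Ω} (hQ : Q x = 0) (hP : P x ≠ 0) :
    renyiDivPos α P Q = ⊤ :=
  if_pos ⟨hα, fun h => hP (h x hQ)⟩

theorem div_rpow_mul_self {p q : ℝ} (hp : 0 < p) (hq : 0 < q) (α : ℝ) :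
    (p / q) ^ α * q = p ^ α * q ^ (1 - α) := by
  rw [Real.div_rpow hp.le hq.le, Real.rpow_sub hq, Real.rpow_one, div_mul_eq_mul_div,
    mul_div_assoc]

theorem renyiDivPos_eq_mul_log (hα0 : α ≠ 0) (hα1 : α ≠ 1) (hP : ∀ x, 0 ≤ P x)
    (hQ : ∀ x, 0 ≤ Q x) (h : 1 < α → ∀ x, Q x = 0 → P x = 0) :
    renyiDivPos α P Q = ((1 / (α * (α - 1)) : ℝ) : EReal) *
      ENNReal.log (ENNReal.ofReal (∑ x, P x ^ α * Q x ^ (1 - α))) := by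
  classical
  rw [renyiDivPos, if_neg fun hc => hc.2 (h hc.1), Finset.sum_filter]
  congr 3
  refine Finset.sum_congr rfl fun x _ => ?_
  obtain hP0 | hP0 := (hP x).eq_or_lt
  · simp only [← hP0, zero_mul, lt_irrefl, if_false, Real.zero_rpow hα0]
  obtain hQ0 | hQ0 := (hQ x).eq_or_lt
  · simp only [← hQ0, mul_zero, lt_irrefl, if_false, Real.zero_rpow (sub_ne_zero.2 hα1.symm)]
  rw [if_pos (mul_pos hP0 hQ0), div_rpow_mul_self hP0 hQ0]

end RenyiDivergence

namespace MarkovDist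

open Matrix

variable {S : Type*} [Fintype S] {μ ν θ : MarkovDist S}

section Basic

theorem marginal_nonneg (ν : MarkovDist S) (i : S) : 0 ≤ ν.marginal i :=
  Finset.sum_nonneg fun j _ => ν.prob_nonneg i j

theorem prob_le_marginal (ν : MarkovDist S) (i j : S) : ν.prob i j ≤ ν.marginal i :=
  Finset.single_le_sum (fun k _ => ν.prob_nonneg i k) (Finset.mem_univ j)

theorem prob_le_marginal_right (ν : MarkovDist S) (i j : S) : ν.prob i j ≤ ν.marginal j :=
  calc ν.prob i j ≤ ∑ k, ν.prob k j :=
        Finset.single_le_sum (f := (ν.prob · j)) (fun k _ => ν.prob_nonneg k j) (Finset.mem_univ i)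
    _ = ν.marginal j := (ν.marginal_eq j).symm

theorem prob_eq_zero_of_marginal_eq_zero {i : S} (hi : ν.marginal i = 0) (j : S) :
    ν.prob i j = 0 :=
  le_antisymm (hi ▸ ν.prob_le_marginal i j) (ν.prob_nonneg i j)

theorem sum_marginal (ν : MarkovDist S) : ∑ i, ν.marginal i = 1 := ν.sum_prob

theorem nonempty (ν : MarkovDist S) : Nonempty S := by
  by_contra h
  have := not_nonempty_iff.1 h
  simpa only [Finset.univ_eq_empty, Finset.sum_empty, zero_ne_one] using ν.sum_prob

theorem trans_nonneg (ν : MarkovDist S) (i j : S) : 0 ≤ ν.trans i j := by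
  unfold trans
  split_ifs with h
  · exact div_nonneg (ν.prob_nonneg i j) h.le
  · exact le_rfl

theorem marginal_mul_trans (ν : MarkovDist S) (i j : S) :
    ν.marginal i * ν.trans i j = ν.prob i j := by
  unfold trans
  split_ifs with h
  · exact mul_div_cancel₀ _ h.ne'
  · rw [mul_zero, prob_eq_zero_of_marginal_eq_zero (le_antisymm (not_lt.1 h) (ν.marginal_nonneg i))]

theorem trans_eq_zero_iff {i j : S} : ν.trans i j = 0 ↔ ν.prob i j = 0 := by
  refine ⟨fun h => by rw [← marginal_mul_trans, h, mul_zero], fun h => ?_⟩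
  rw [trans, h, zero_div, ite_self]

theorem trans_pos_iff {i j : S} : 0 < ν.trans i j ↔ 0 < ν.prob i j := by
  rw [(ν.trans_nonneg i j).lt_iff_ne', (ν.prob_nonneg i j).lt_iff_ne', ne_eq, ne_eq,
    trans_eq_zero_iff]

theorem sum_prob_mul_const (μ : MarkovDist S) (c : ℝ) : ∑ i, ∑ j, μ.prob i j * c = c := by
  simp only [← Finset.sum_mul, μ.sum_prob, one_mul]

theorem sum_prob_mul_sub (μ : MarkovDist S) (f : S → ℝ) :
    ∑ i, ∑ j, μ.prob i j * (f j - f i) = 0 := by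
  simp only [mul_sub, Finset.sum_sub_distrib]
  rw [sub_eq_zero, Finset.sum_comm]
  simp only [← Finset.sum_mul, μ.marginal_eq]

theorem AbsCont.refl (ν : MarkovDist S) : ν.AbsCont ν := fun _ _ h => h

theorem AbsCont.trans (h : μ.AbsCont ν) (h' : ν.AbsCont θ) : μ.AbsCont θ :=
  fun i j hij => h i j (h' i j hij)

theorem AbsCont.trans_ne_zero (h : μ.AbsCont ν) {i j : S} (hμ : μ.prob i j ≠ 0) :
    ν.trans i j ≠ 0 :=
  fun hν => hμ (h i j (trans_eq_zero_iff.1 hν))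

theorem AbsCont.marginal_eq_zero (h : μ.AbsCont ν) {i : S} (hi : ν.marginal i = 0) :
    μ.marginal i = 0 :=
  Finset.sum_eq_zero fun j _ => h i j (prob_eq_zero_of_marginal_eq_zero hi j)

end Basic

section FreeEnergy

variable {A P : Matrix S S ℝ} {r s : ℝ} {C : Finset S} {u w : S → ℝ}

/-- `μ` only charges the pairs `(i, j)` at which the matrix `A` does not vanish. -/
def SupportedOn (μ : MarkovDist S) (A : Matrix S S ℝ) : Prop := ∀ i j, A i j = 0 → μ.prob i j = 0

/-- The free energy of `μ` with respect to a nonnegative matrix `A`: the entropy rate of `μ` plus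
the mean of `log A`. It is meaningful for `μ` supported on `A`; by Lean's conventions a pair with
`μ(i, j) = 0` contributes `0`. -/
noncomputable def freeEnergy (A : Matrix S S ℝ) (μ : MarkovDist S) : ℝ :=
  ∑ i, ∑ j, μ.prob i j * Real.log (A i j / μ.trans i j)

theorem freeEnergy_trans (μ : MarkovDist S) : freeEnergy (of μ.trans) μ = 0 := by
  refine Finset.sum_eq_zero fun i _ => Finset.sum_eq_zero fun j _ => ?_
  obtain h | h := eq_or_ne (μ.prob i j) 0
  · rw [h, zero_mul]
  · rw [of_apply, div_self (trans_eq_zero_iff.not.2 h), Real.log_one, mul_zero]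

-- By stationarity of `μ`, the telescoping term `log v j - log v i` has mean zero.
theorem freeEnergy_eq_log_add {v : S → ℝ} (hs : s ≠ 0)
    (h : ∀ i j, μ.prob i j ≠ 0 →
      v i ≠ 0 ∧ P i j ≠ 0 ∧ A i j * v j = s * (v i * P i j)) :
    freeEnergy A μ = Real.log s + freeEnergy P μ := by
  have hterm (i j : S) : μ.prob i j * Real.log (A i j / μ.trans i j) =
      μ.prob i j * Real.log s + μ.prob i j * Real.log (P i j / μ.trans i j) -
        μ.prob i j * (Real.log (v j) - Real.log (v i)) := by
    obtain hμ | hμ := eq_or_ne (μ.prob i j) 0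
    · simp only [hμ, zero_mul, add_zero, sub_zero]
    obtain ⟨hvi, hP, heq⟩ := h i j hμ
    have htrans : μ.trans i j ≠ 0 := trans_eq_zero_iff.not.2 hμ
    have hAv : A i j * v j ≠ 0 := heq ▸ mul_ne_zero hs (mul_ne_zero hvi hP)
    have hlog := congrArg Real.log heq
    rw [Real.log_mul (left_ne_zero_of_mul hAv) (right_ne_zero_of_mul hAv),
      Real.log_mul hs (mul_ne_zero hvi hP), Real.log_mul hvi hP] at hlog
    rw [Real.log_div (left_ne_zero_of_mul hAv) htrans, Real.log_div hP htrans]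
    linear_combination μ.prob i j * hlog
  simp only [freeEnergy, hterm, Finset.sum_sub_distrib, Finset.sum_add_distrib,
    μ.sum_prob_mul_const]
  rw [μ.sum_prob_mul_sub fun i => Real.log (v i), sub_zero]

theorem freeEnergy_nonpos (hP : ∀ i j, 0 ≤ P i j) (hsum : ∀ i, ∑ j, P i j ≤ 1)
    (hμ : μ.SupportedOn P) : freeEnergy P μ ≤ 0 := by
  have hterm (i j : S) : μ.prob i j * Real.log (P i j / μ.trans i j) ≤
      μ.marginal i * P i j - μ.prob i j := by
    obtain h | h := (μ.prob_nonneg i j).eq_or_lt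
    · rw [← h, zero_mul, sub_zero]
      exact mul_nonneg (μ.marginal_nonneg i) (hP i j)
    have htrans : 0 < μ.trans i j := trans_pos_iff.2 h
    have hPij : 0 < P i j := lt_of_le_of_ne (hP i j) fun h0 => h.ne' (hμ i j h0.symm)
    calc μ.prob i j * Real.log (P i j / μ.trans i j)
        ≤ μ.prob i j * (P i j / μ.trans i j - 1) := mul_le_mul_of_nonneg_left
          (Real.log_le_sub_one_of_pos (div_pos hPij htrans)) h.le
      _ = μ.marginal i * P i j - μ.prob i j := by
        rw [← marginal_mul_trans, mul_sub, mul_one, mul_assoc, mul_div_cancel₀ _ htrans.ne']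
  calc freeEnergy P μ ≤ ∑ i, ∑ j, (μ.marginal i * P i j - μ.prob i j) :=
        Finset.sum_le_sum fun i _ => Finset.sum_le_sum fun j _ => hterm i j
    _ = ∑ i, μ.marginal i * ∑ j, P i j - 1 := by
        simp only [Finset.sum_sub_distrib, μ.sum_prob, Finset.mul_sum]
    _ ≤ ∑ i, μ.marginal i - 1 := sub_le_sub_right (Finset.sum_le_sum fun i _ =>
        mul_le_of_le_one_right (μ.marginal_nonneg i) (hsum i)) 1
    _ = 0 := by rw [sum_marginal, sub_self]

theorem freeEnergy_le_log (hA : ∀ i j, 0 ≤ A i j) (hμ : μ.SupportedOn A) (hs : 0 < s)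
    (h : HasPosSubinvariantVector A s) : freeEnergy A μ ≤ Real.log s := by
  obtain ⟨v, hv, hAv⟩ := h
  have hsv (i : S) : 0 < s * v i := mul_pos hs (hv i)
  let P : Matrix S S ℝ := of fun i j => A i j * v j / (s * v i)
  have hP_nonneg (i j : S) : 0 ≤ P i j := div_nonneg (mul_nonneg (hA i j) (hv j).le) (hsv i).le
  have hP_sum (i : S) : ∑ j, P i j ≤ 1 := by
    simp only [P, of_apply, ← Finset.sum_div]
    exact (div_le_one (hsv i)).2 (hAv i)
  have hP_eq_zero {i j : S} (h : P i j = 0) : A i j = 0 :=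
    (mul_eq_zero.1 ((div_eq_zero_iff.1 h).resolve_right (hsv i).ne')).resolve_right (hv j).ne'
  have hP_apply (i j : S) : s * v i * P i j = A i j * v j := mul_div_cancel₀ _ (hsv i).ne'
  have hgauge : freeEnergy A μ = Real.log s + freeEnergy P μ :=
    freeEnergy_eq_log_add (v := v) hs.ne' fun i j hij =>
      ⟨(hv i).ne', fun h => hij (hμ i j (hP_eq_zero h)), by rw [← mul_assoc, hP_apply]⟩
  rw [hgauge]
  exact add_le_of_nonpos_right
    (freeEnergy_nonpos hP_nonneg hP_sum fun i j h => hμ i j (hP_eq_zero h))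

theorem exp_freeEnergy_le (hr : IsPerronRoot A r) (hA : ∀ i j, 0 ≤ A i j)
    (hμ : μ.SupportedOn A) : Real.exp (freeEnergy A μ) ≤ r := by
  refine le_of_forall_gt_imp_ge_of_dense fun s hs => ?_
  have hs0 : 0 < s := hr.nonneg.trans_lt hs
  exact (Real.le_log_iff_exp_le hs0).1
    (freeEnergy_le_log hA hμ hs0 (hr.hasPosSubinvariantVector s hs))

/-- The stationary distribution `u(i) A(i, j) w(j) / Z` on pairs of the Doob transform of the
irreducible block `C` of `A`; it maximizes the free energy when `r` is the Perron root. -/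
noncomputable def perronTilt (h : IsPerronClass A r C u w) (hA : ∀ i j, 0 ≤ A i j) (hr : 0 < r) :
    MarkovDist S where
  prob i j := u i * A i j * w j / ∑ k, ∑ l, u k * A k l * w l
  prob_nonneg i j := div_nonneg (mul_nonneg (mul_nonneg (h.transpose.right_nonneg i) (hA i j))
    (h.right_nonneg j)) (h.sum_sum_pos hr).le
  sum_prob := by simp only [← Finset.sum_div, div_self (h.sum_sum_pos hr).ne']
  marginal_eq k := by simp only [← Finset.sum_div, h.sum_right, h.sum_left]

variable (h : IsPerronClass A r C u w) (hA : ∀ i j, 0 ≤ A i j) (hr : 0 < r)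

theorem prob_perronTilt (i j : S) :
    (perronTilt h hA hr).prob i j = u i * A i j * w j / ∑ k, ∑ l, u k * A k l * w l := rfl

theorem supportedOn_perronTilt : (perronTilt h hA hr).SupportedOn A := fun i j hij => by
  rw [prob_perronTilt, hij, mul_zero, zero_mul, zero_div]

theorem marginal_perronTilt (i : S) :
    (perronTilt h hA hr).marginal i = r * (u i * w i) / ∑ k, ∑ l, u k * A k l * w l := by
  simp only [marginal, prob_perronTilt, ← Finset.sum_div, h.sum_right]

theorem freeEnergy_perronTilt : freeEnergy A (perronTilt h hA hr) = Real.log r := by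
  have hgauge := freeEnergy_eq_log_add (A := A) (μ := perronTilt h hA hr)
    (P := of (perronTilt h hA hr).trans) (v := w) hr.ne' fun i j hij => by
      have hmarg := marginal_mul_trans (perronTilt h hA hr) i j
      have hprod := mul_ne_zero_iff.1 (hmarg.trans_ne hij)
      rw [marginal_perronTilt] at hprod hmarg
      have hruw := (div_ne_zero_iff.1 hprod.1).1
      have hui := left_ne_zero_of_mul (right_ne_zero_of_mul hruw)
      refine ⟨right_ne_zero_of_mul (right_ne_zero_of_mul hruw), hprod.2, ?_⟩
      rw [prob_perronTilt, div_mul_eq_mul_div, div_left_inj' (h.sum_sum_pos hr).ne'] at hmarg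
      refine mul_left_cancel₀ hui ?_
      rw [of_apply]
      linear_combination -hmarg
  rw [hgauge, freeEnergy_trans, add_zero]

end FreeEnergy

section TiltedMatrix

variable {α r : ℝ} {C : Finset S} {u w : S → ℝ}

theorem tiltedMatrix_apply (α : ℝ) (ν θ : MarkovDist S) (i j : S) :
    tiltedMatrix α ν θ i j = ν.trans i j ^ α * θ.trans i j ^ (1 - α) := rfl

theorem tiltedMatrix_nonneg (α : ℝ) (ν θ : MarkovDist S) (i j : S) :
    0 ≤ tiltedMatrix α ν θ i j :=
  mul_nonneg (Real.rpow_nonneg (ν.trans_nonneg i j) _) (Real.rpow_nonneg (θ.trans_nonneg i j) _)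

theorem tiltedMatrix_eq_zero_iff (hα0 : α ≠ 0) (hα1 : α ≠ 1) {i j : S} :
    tiltedMatrix α ν θ i j = 0 ↔ ν.prob i j = 0 ∨ θ.prob i j = 0 := by
  rw [tiltedMatrix_apply, mul_eq_zero, Real.rpow_eq_zero (ν.trans_nonneg i j) hα0,
    Real.rpow_eq_zero (θ.trans_nonneg i j) (sub_ne_zero.2 hα1.symm), trans_eq_zero_iff,
    trans_eq_zero_iff]

theorem supportedOn_tiltedMatrix_iff (hα0 : α ≠ 0) (hα1 : α ≠ 1) :
    μ.SupportedOn (tiltedMatrix α ν θ) ↔ μ.AbsCont ν ∧ μ.AbsCont θ := by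
  simp only [SupportedOn, AbsCont, tiltedMatrix_eq_zero_iff hα0 hα1, or_imp, forall_and]

theorem exists_isPerronRoot_tiltedMatrix (α : ℝ) (ν θ : MarkovDist S) :
    ∃ r, IsPerronRoot (tiltedMatrix α ν θ) r :=
  have := ν.nonempty
  exists_isPerronRoot (tiltedMatrix_nonneg α ν θ)

theorem isPerronTilt_perronTilt (h : IsPerronClass (tiltedMatrix α ν θ) r C u w) (hr : 0 < r) :
    IsPerronTilt α ν θ (perronTilt h (tiltedMatrix_nonneg α ν θ) hr) :=
  ⟨C, r, u, w, h.isIrreducible, hr, h.pos, h.eq_zero, h.left_eigen, h.right_eigen,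
    prob_perronTilt h _ hr⟩

theorem tiltedMatrix_one_sub (α : ℝ) (ν θ : MarkovDist S) :
    tiltedMatrix (1 - α) θ ν = tiltedMatrix α ν θ := by
  ext i j
  rw [tiltedMatrix_apply, tiltedMatrix_apply, sub_sub_cancel, mul_comm]

end TiltedMatrix

section Objective

variable {α : ℝ}

theorem prob_eq_zero_of_notMem_support {i : S} (hi : i ∉ μ.support) (j : S) : μ.prob i j = 0 :=
  le_antisymm ((μ.prob_le_marginal i j).trans (by simpa [support] using hi)) (μ.prob_nonneg i j)

theorem prob_eq_zero_of_notMem_support_right (i : S) {j : S} (hj : j ∉ μ.support) :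
    μ.prob i j = 0 :=
  le_antisymm ((μ.prob_le_marginal_right i j).trans (by simpa [support] using hj))
    (μ.prob_nonneg i j)

theorem relEnt_of_absCont (h : μ.AbsCont θ) :
    μ.relEnt θ = ((-freeEnergy (of θ.trans) μ : ℝ) : EReal) := by
  have hlog (i j : S) : μ.prob i j * Real.log (μ.trans i j / θ.trans i j) =
      -(μ.prob i j * Real.log (θ.trans i j / μ.trans i j)) := by
    rw [← inv_div, Real.log_inv, mul_neg]
  rw [relEnt, if_pos h, freeEnergy, ← Finset.sum_neg_distrib]
  simp only [hlog, of_apply, ← Finset.sum_neg_distrib]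
  congr 1
  refine (Finset.sum_congr rfl fun i _ => Finset.sum_subset μ.support.subset_univ fun j _ hj => ?_)
    |>.trans (Finset.sum_subset μ.support.subset_univ fun i _ hi =>
      Finset.sum_eq_zero fun j _ => ?_)
  · rw [prob_eq_zero_of_notMem_support_right i hj, zero_mul, neg_zero]
  · rw [prob_eq_zero_of_notMem_support hi, zero_mul, neg_zero]

theorem freeEnergy_tiltedMatrix (α : ℝ) (hν : μ.AbsCont ν) (hθ : μ.AbsCont θ) :
    freeEnergy (tiltedMatrix α ν θ) μ =
      α * freeEnergy (of ν.trans) μ + (1 - α) * freeEnergy (of θ.trans) μ := by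
  simp only [freeEnergy, Finset.mul_sum, ← Finset.sum_add_distrib]
  refine Finset.sum_congr rfl fun i _ => Finset.sum_congr rfl fun j _ => ?_
  obtain h | h := eq_or_ne (μ.prob i j) 0
  · simp only [h, zero_mul, mul_zero, add_zero]
  have hνij : 0 < ν.trans i j := (ν.trans_nonneg i j).lt_of_ne' (hν.trans_ne_zero h)
  have hθij : 0 < θ.trans i j := (θ.trans_nonneg i j).lt_of_ne' (hθ.trans_ne_zero h)
  have hμij : μ.trans i j ≠ 0 := trans_eq_zero_iff.not.2 h
  rw [tiltedMatrix_apply, of_apply, of_apply, Real.log_div hνij.ne' hμij,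
    Real.log_div hθij.ne' hμij, Real.log_div (by positivity) hμij,
    Real.log_mul (by positivity) (by positivity), Real.log_rpow hνij, Real.log_rpow hθij]
  ring

theorem objective_of_absCont (hα0 : α ≠ 0) (hα1 : α ≠ 1) (hν : μ.AbsCont ν) (hθ : μ.AbsCont θ) :
    objective α ν θ μ = ((1 / (α * (α - 1)) * freeEnergy (tiltedMatrix α ν θ) μ : ℝ) : EReal) := by
  have hα1' : α - 1 ≠ 0 := sub_ne_zero.2 hα1
  rw [objective, relEnt_of_absCont hν, relEnt_of_absCont hθ, freeEnergy_tiltedMatrix α hν hθ,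
    ← EReal.coe_mul, ← EReal.coe_mul, ← EReal.coe_sub]
  congr 1
  field_simp
  ring

theorem objective_self_eq_top (hα : 0 < α) (h : ¬ ν.AbsCont θ) : objective α ν θ ν = ⊤ := by
  rw [objective, relEnt_of_absCont (.refl ν), relEnt, if_neg h,
    EReal.coe_mul_top_of_pos (one_div_pos.2 hα), ← EReal.coe_mul, EReal.top_sub_coe]

theorem objective_one_sub (α : ℝ) (ν θ μ : MarkovDist S) :
    objective (1 - α) θ ν μ = objective α ν θ μ := by
  have h1 : 1 / (1 - α) = -(1 / (α - 1)) := by rw [← neg_sub, one_div_neg_eq_neg_one_div]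
  have h2 : 1 / (1 - α - 1) = -(1 / α) := by rw [sub_sub_cancel_left, one_div_neg_eq_neg_one_div]
  rw [objective, objective, h1, h2, EReal.coe_neg, EReal.coe_neg, EReal.neg_mul, EReal.neg_mul,
    sub_eq_add_neg, neg_neg, add_comm]
  exact (sub_eq_add_neg _ _).symm

end Objective

section PathLaw

variable {α : ℝ} {n : ℕ}

theorem pathLaw_nonneg (ν : MarkovDist S) (n : ℕ) (x : Fin (n + 1) → S) : 0 ≤ ν.pathLaw n x :=
  mul_nonneg (ν.marginal_nonneg _) (Finset.prod_nonneg fun _ _ => ν.trans_nonneg _ _)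

theorem AbsCont.pathLaw_eq_zero (h : ν.AbsCont θ) {x : Fin (n + 1) → S}
    (hx : θ.pathLaw n x = 0) : ν.pathLaw n x = 0 := by
  obtain h0 | h0 := mul_eq_zero.1 hx
  · rw [pathLaw, h.marginal_eq_zero h0, zero_mul]
  · obtain ⟨k, hk, h1⟩ := Finset.prod_eq_zero_iff.1 h0
    rw [pathLaw, Finset.prod_eq_zero hk, mul_zero]
    exact trans_eq_zero_iff.2 (h _ _ (trans_eq_zero_iff.1 h1))

theorem pathLaw_cons (ν : MarkovDist S) (i : S) (x : Fin (n + 1) → S) :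
    ν.pathLaw (n + 1) (Fin.cons i x) =
      ν.prob i (x 0) * ∏ k : Fin n, ν.trans (x k.castSucc) (x k.succ) := by
  rw [pathLaw, Fin.prod_univ_succ]
  simp only [Fin.castSucc_zero, Fin.cons_zero, Fin.cons_succ, ← Fin.succ_castSucc, ← mul_assoc,
    marginal_mul_trans]

theorem pathLaw_cons_pos {i : S} {x : Fin (n + 1) → S} (hi : 0 < ν.prob i (x 0))
    (hx : 0 < ν.pathLaw n x) : 0 < ν.pathLaw (n + 1) (Fin.cons i x) := by
  rw [pathLaw_cons]
  exact mul_pos hi (pos_of_mul_pos_right hx (ν.marginal_nonneg _))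

theorem exists_pathLaw_pos {i : S} (hi : 0 < ν.marginal i) (n : ℕ) :
    ∃ x, x 0 = i ∧ 0 < ν.pathLaw n x := by
  induction n generalizing i with
  | zero => exact ⟨fun _ => i, rfl, by simpa [pathLaw] using hi⟩
  | succ n ih =>
    obtain ⟨j, -, hij⟩ := Finset.exists_ne_zero_of_sum_ne_zero hi.ne'
    have hij : 0 < ν.prob i j := (ν.prob_nonneg i j).lt_of_ne' hij
    obtain ⟨x, rfl, hx⟩ := ih (hij.trans_le (ν.prob_le_marginal_right i j))
    exact ⟨Fin.cons i x, rfl, pathLaw_cons_pos hij hx⟩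

theorem exists_pathLaw_eq_zero_and_pos (h : ¬ ν.AbsCont θ) (n : ℕ) :
    ∃ x, θ.pathLaw (n + 1) x = 0 ∧ 0 < ν.pathLaw (n + 1) x := by
  simp only [AbsCont, not_forall] at h
  obtain ⟨i, j, hθ, hν⟩ := h
  have hν : 0 < ν.prob i j := (ν.prob_nonneg i j).lt_of_ne' hν
  obtain ⟨x, rfl, hx⟩ := exists_pathLaw_pos (hν.trans_le (ν.prob_le_marginal_right i j)) n
  exact ⟨Fin.cons i x, by rw [pathLaw_cons, hθ, zero_mul], pathLaw_cons_pos hν hx⟩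

/-- The weights `ν(i, *) ^ α θ(i, *) ^ (1 - α)` of the initial states in the sum defining the Rényi
divergence between path laws. -/
noncomputable def tiltedInit (α : ℝ) (ν θ : MarkovDist S) (i : S) : ℝ :=
  ν.marginal i ^ α * θ.marginal i ^ (1 - α)

theorem tiltedInit_nonneg (α : ℝ) (ν θ : MarkovDist S) : 0 ≤ tiltedInit α ν θ := fun i =>
  mul_nonneg (Real.rpow_nonneg (ν.marginal_nonneg i) _) (Real.rpow_nonneg (θ.marginal_nonneg i) _)

theorem tiltedInit_pos_of_tiltedMatrix_pos (hα0 : α ≠ 0) (hα1 : α ≠ 1) (i j : S)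
    (h : 0 < tiltedMatrix α ν θ i j) : 0 < tiltedInit α ν θ i := by
  obtain ⟨hν, hθ⟩ := not_or.1 ((tiltedMatrix_eq_zero_iff hα0 hα1).not.1 h.ne')
  exact mul_pos
    (Real.rpow_pos_of_pos (((ν.prob_nonneg i j).lt_of_ne' hν).trans_le (ν.prob_le_marginal i j)) _)
    (Real.rpow_pos_of_pos (((θ.prob_nonneg i j).lt_of_ne' hθ).trans_le (θ.prob_le_marginal i j)) _)

theorem pathLaw_rpow (α : ℝ) (ν : MarkovDist S) (x : Fin (n + 1) → S) :
    ν.pathLaw n x ^ α =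
      ν.marginal (x 0) ^ α * ∏ k : Fin n, ν.trans (x k.castSucc) (x k.succ) ^ α := by
  rw [pathLaw, Real.mul_rpow (ν.marginal_nonneg _)
    (Finset.prod_nonneg fun _ _ => ν.trans_nonneg _ _),
    Real.finsetProd_rpow _ _ fun _ _ => ν.trans_nonneg _ _]

theorem sum_pathLaw_rpow_mul_rpow [DecidableEq S] (α : ℝ) (ν θ : MarkovDist S) (n : ℕ) :
    ∑ x, ν.pathLaw n x ^ α * θ.pathLaw n x ^ (1 - α) =
      tiltedInit α ν θ ⬝ᵥ tiltedMatrix α ν θ ^ n *ᵥ 1 := by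
  rw [dotProduct_pow_mulVec_eq_sum_paths]
  refine Finset.sum_congr rfl fun x _ => ?_
  rw [pathLaw_rpow, pathLaw_rpow, mul_mul_mul_comm, ← Finset.prod_mul_distrib, Pi.one_apply,
    mul_one]
  rfl

end PathLaw

section RenyiRate

variable {α r : ℝ}

theorem renyiPerStep_one_sub_of_neg (hα : α < 0) (ν θ : MarkovDist S) :
    renyiPerStep (1 - α) θ ν = renyiPerStep α ν θ := by
  funext n
  rw [renyiPerStep, renyiPerStep, renyiDiv_one_sub_of_neg hα]

theorem renyiRate_one_sub_of_neg (hα : α < 0) (ν θ : MarkovDist S) :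
    renyiRate (1 - α) θ ν = renyiRate α ν θ := by
  rw [renyiRate, renyiPerStep_one_sub_of_neg hα, renyiRate]

theorem renyiPerStep_eq_mul_log [DecidableEq S] (hα0 : 0 < α) (hα1 : α ≠ 1)
    (h : 1 < α → ν.AbsCont θ) (n : ℕ) :
    renyiPerStep α ν θ n = ((1 / (α * (α - 1)) : ℝ) : EReal) *
      (((1 / ((n : ℝ) + 1) : ℝ) : EReal) * ENNReal.log (ENNReal.ofReal
        (tiltedInit α ν θ ⬝ᵥ tiltedMatrix α ν θ ^ n *ᵥ 1))) := by
  rw [renyiPerStep, renyiDiv, if_neg hα0.not_gt, renyiDivPos_eq_mul_log hα0.ne' hα1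
    (ν.pathLaw_nonneg n) (θ.pathLaw_nonneg n) fun hα x => (h hα).pathLaw_eq_zero,
    sum_pathLaw_rpow_mul_rpow, mul_left_comm]

theorem tendsto_renyiPerStep_mul_log (hα0 : 0 < α) (hα1 : α ≠ 1) (h : 1 < α → ν.AbsCont θ)
    (hr : IsPerronRoot (tiltedMatrix α ν θ) r) :
    Tendsto (renyiPerStep α ν θ) atTop
      (𝓝 (((1 / (α * (α - 1)) : ℝ) : EReal) * ENNReal.log (ENNReal.ofReal r))) := by
  classical
  have hlim := hr.tendsto_log_dotProduct_pow_mulVec_one (tiltedMatrix_nonneg α ν θ)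
    (tiltedInit_nonneg α ν θ) (tiltedInit_pos_of_tiltedMatrix_pos hα0.ne' hα1)
  exact (EReal.Tendsto.const_mul hlim (.inl (EReal.coe_ne_bot _)) (.inl (EReal.coe_ne_top _))).congr
    fun n => (renyiPerStep_eq_mul_log hα0 hα1 h n).symm

theorem tendsto_renyiPerStep_top (hα : 1 < α) (h : ¬ ν.AbsCont θ) :
    Tendsto (renyiPerStep α ν θ) atTop (𝓝 ⊤) := by
  refine tendsto_const_nhds.congr' ((eventually_ge_atTop 1).mono fun n hn => ?_)
  obtain ⟨m, rfl⟩ := Nat.exists_eq_add_of_le' hn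
  obtain ⟨x, hθ, hν⟩ := exists_pathLaw_eq_zero_and_pos h m
  rw [renyiPerStep, renyiDiv, if_neg (zero_lt_one.trans hα).not_gt,
    renyiDivPos_eq_top hα hθ hν.ne', EReal.coe_mul_top_of_pos Nat.one_div_pos_of_nat]

theorem tendsto_renyiPerStep_of_pos (hα0 : 0 < α) (hα1 : α ≠ 1) (ν θ : MarkovDist S) :
    Tendsto (renyiPerStep α ν θ) atTop (𝓝 (renyiRate α ν θ)) := by
  refine tendsto_nhds_limUnder ?_
  by_cases h : 1 < α → ν.AbsCont θ
  · obtain ⟨r, hr⟩ := exists_isPerronRoot_tiltedMatrix α ν θ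
    exact ⟨_, tendsto_renyiPerStep_mul_log hα0 hα1 h hr⟩
  · obtain ⟨hα, h⟩ := Classical.not_imp.1 h
    exact ⟨⊤, tendsto_renyiPerStep_top hα h⟩

theorem tendsto_renyiPerStep_renyiRate (hα0 : α ≠ 0) (hα1 : α ≠ 1) (ν θ : MarkovDist S) :
    Tendsto (renyiPerStep α ν θ) atTop (𝓝 (renyiRate α ν θ)) := by
  obtain hα | hα := hα0.lt_or_gt
  · rw [← renyiPerStep_one_sub_of_neg hα, ← renyiRate_one_sub_of_neg hα]
    exact tendsto_renyiPerStep_of_pos (by linarith) (by simpa using hα0) θ ν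
  · exact tendsto_renyiPerStep_of_pos hα hα1 ν θ

theorem renyiRate_eq_top (hα : 1 < α) (h : ¬ ν.AbsCont θ) : renyiRate α ν θ = ⊤ :=
  (tendsto_renyiPerStep_top hα h).limUnder_eq

theorem renyiRate_eq_mul_log (hα0 : 0 < α) (hα1 : α ≠ 1) (h : 1 < α → ν.AbsCont θ)
    (hr : IsPerronRoot (tiltedMatrix α ν θ) r) :
    renyiRate α ν θ = ((1 / (α * (α - 1)) : ℝ) : EReal) * ENNReal.log (ENNReal.ofReal r) :=
  (tendsto_renyiPerStep_mul_log hα0 hα1 h hr).limUnder_eq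

theorem renyiRate_eq_coe (hα0 : 0 < α) (hα1 : α ≠ 1) (h : 1 < α → ν.AbsCont θ)
    (hr : IsPerronRoot (tiltedMatrix α ν θ) r) (hr0 : 0 < r) :
    renyiRate α ν θ = ((1 / (α * (α - 1)) * Real.log r : ℝ) : EReal) := by
  rw [renyiRate_eq_mul_log hα0 hα1 h hr, ENNReal.log_ofReal_of_pos hr0, ← EReal.coe_mul]

theorem exp_freeEnergy_tiltedMatrix_le (hα0 : α ≠ 0) (hα1 : α ≠ 1)
    (hr : IsPerronRoot (tiltedMatrix α ν θ) r) (hμ : μ.AbsCont ν ∧ μ.AbsCont θ) :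
    Real.exp (freeEnergy (tiltedMatrix α ν θ) μ) ≤ r :=
  exp_freeEnergy_le hr (tiltedMatrix_nonneg α ν θ) ((supportedOn_tiltedMatrix_iff hα0 hα1).2 hμ)

end RenyiRate

section Variational

variable {α : ℝ}

theorem exists_isPerronTilt_objective_eq_renyiRate (hα0 : 0 < α) (hα1 : α ≠ 1)
    (h : 1 < α → ν.AbsCont θ) (hμ : ∃ μ : MarkovDist S, μ.AbsCont ν ∧ μ.AbsCont θ) :
    ∃ μ : MarkovDist S, (μ.AbsCont ν ∧ μ.AbsCont θ) ∧ objective α ν θ μ = renyiRate α ν θ ∧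
      IsPerronTilt α ν θ μ := by
  obtain ⟨r, hr⟩ := exists_isPerronRoot_tiltedMatrix α ν θ
  have hr0 : 0 < r := hμ.elim fun _ hμ =>
    (Real.exp_pos _).trans_le (exp_freeEnergy_tiltedMatrix_le hα0.ne' hα1 hr hμ)
  obtain ⟨C, u, w, hC⟩ := hr.exists_isPerronClass hr0
  have hsupp := (supportedOn_tiltedMatrix_iff hα0.ne' hα1).1
    (supportedOn_perronTilt hC (tiltedMatrix_nonneg α ν θ) hr0)
  refine ⟨_, hsupp, ?_, isPerronTilt_perronTilt hC hr0⟩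
  rw [objective_of_absCont hα0.ne' hα1 hsupp.1 hsupp.2, freeEnergy_perronTilt,
    renyiRate_eq_coe hα0 hα1 h hr hr0]

theorem objective_le_renyiRate (hα : 1 < α) (hμ : μ.AbsCont ν) :
    objective α ν θ μ ≤ renyiRate α ν θ := by
  have hα0 : 0 < α := zero_lt_one.trans hα
  by_cases h : ν.AbsCont θ
  · obtain ⟨r, hr⟩ := exists_isPerronRoot_tiltedMatrix α ν θ
    have hle := exp_freeEnergy_tiltedMatrix_le hα0.ne' hα.ne' hr ⟨hμ, hμ.trans h⟩
    have hr0 : 0 < r := (Real.exp_pos _).trans_le hle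
    rw [objective_of_absCont hα0.ne' hα.ne' hμ (hμ.trans h),
      renyiRate_eq_coe hα0 hα.ne' (fun _ => h) hr hr0, EReal.coe_le_coe_iff]
    exact mul_le_mul_of_nonneg_left ((Real.le_log_iff_exp_le hr0).2 hle)
      (one_div_nonneg.2 (mul_nonneg hα0.le (sub_nonneg.2 hα.le)))
  · exact le_top.trans_eq (renyiRate_eq_top hα h).symm

theorem renyiRate_le_objective (hα0 : 0 < α) (hα1 : α < 1) (hμ : μ.AbsCont ν ∧ μ.AbsCont θ) :
    renyiRate α ν θ ≤ objective α ν θ μ := by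
  obtain ⟨r, hr⟩ := exists_isPerronRoot_tiltedMatrix α ν θ
  have hle := exp_freeEnergy_tiltedMatrix_le hα0.ne' hα1.ne hr hμ
  have hr0 : 0 < r := (Real.exp_pos _).trans_le hle
  rw [objective_of_absCont hα0.ne' hα1.ne hμ.1 hμ.2,
    renyiRate_eq_coe hα0 hα1.ne (absurd · hα1.not_gt) hr hr0, EReal.coe_le_coe_iff]
  exact mul_le_mul_of_nonpos_left ((Real.le_log_iff_exp_le hr0).2 hle)
    (one_div_nonpos.2 (mul_nonpos_of_nonneg_of_nonpos hα0.le (sub_nonpos.2 hα1.le)))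

theorem renyiRate_eq_top_of_forall_not_absCont (hα0 : 0 < α) (hα1 : α < 1)
    (h : ∀ μ : MarkovDist S, ¬ (μ.AbsCont ν ∧ μ.AbsCont θ)) : renyiRate α ν θ = ⊤ := by
  obtain ⟨r, hr⟩ := exists_isPerronRoot_tiltedMatrix α ν θ
  have hr0 : r = 0 := by
    refine le_antisymm (not_lt.1 fun hr0 => ?_) hr.nonneg
    obtain ⟨C, u, w, hC⟩ := hr.exists_isPerronClass hr0
    exact h _ ((supportedOn_tiltedMatrix_iff hα0.ne' hα1.ne).1
      (supportedOn_perronTilt hC (tiltedMatrix_nonneg α ν θ) hr0))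
  rw [renyiRate_eq_mul_log hα0 hα1.ne (absurd · hα1.not_gt) hr, hr0, ENNReal.ofReal_zero,
    ENNReal.log_zero,
    EReal.coe_mul_bot_of_neg (one_div_neg.2 (mul_neg_of_pos_of_neg hα0 (sub_neg.2 hα1)))]

theorem exists_objective_eq_renyiRate_of_one_lt (hα : 1 < α) (ν θ : MarkovDist S) :
    ∃ μ : MarkovDist S, μ.AbsCont ν ∧ objective α ν θ μ = renyiRate α ν θ ∧
      (ν.AbsCont θ → IsPerronTilt α ν θ μ) := by
  have hα0 : 0 < α := zero_lt_one.trans hα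
  by_cases h : ν.AbsCont θ
  · obtain ⟨μ, hμ, heq, htilt⟩ := exists_isPerronTilt_objective_eq_renyiRate hα0 hα.ne'
      (fun _ => h) ⟨ν, .refl ν, h⟩
    exact ⟨μ, hμ.1, heq, fun _ => htilt⟩
  · exact ⟨ν, .refl ν, (objective_self_eq_top hα0 h).trans (renyiRate_eq_top hα h).symm,
      fun h' => absurd h' h⟩

theorem renyiRate_eq_iSup_of_one_lt (hα : 1 < α) (ν θ : MarkovDist S) :
    renyiRate α ν θ = ⨆ (μ : MarkovDist S) (_ : μ.AbsCont ν), objective α ν θ μ := by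
  obtain ⟨μ, hμ, heq, -⟩ := exists_objective_eq_renyiRate_of_one_lt hα ν θ
  exact le_antisymm (le_iSup₂_of_le μ hμ heq.ge) (iSup₂_le fun _ => objective_le_renyiRate hα)

theorem renyiRate_eq_iInf_of_lt_one (hα0 : 0 < α) (hα1 : α < 1) (ν θ : MarkovDist S) :
    renyiRate α ν θ =
      ⨅ (μ : MarkovDist S) (_ : μ.AbsCont ν ∧ μ.AbsCont θ), objective α ν θ μ := by
  refine le_antisymm (le_iInf₂ fun _ => renyiRate_le_objective hα0 hα1) ?_
  by_cases h : ∃ μ : MarkovDist S, μ.AbsCont ν ∧ μ.AbsCont θ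
  · obtain ⟨μ, hμ, heq, -⟩ := exists_isPerronTilt_objective_eq_renyiRate hα0 hα1.ne
      (absurd · hα1.not_gt) h
    exact iInf₂_le_of_le μ hμ heq.le
  · exact le_top.trans_eq (renyiRate_eq_top_of_forall_not_absCont hα0 hα1 (not_exists.1 h)).symm

theorem exists_objective_eq_renyiRate_of_neg (hα : α < 0) (ν θ : MarkovDist S) :
    ∃ μ : MarkovDist S, μ.AbsCont θ ∧ objective α ν θ μ = renyiRate α ν θ ∧
      (θ.AbsCont ν → IsPerronTilt α ν θ μ) := by
  simpa only [objective_one_sub, renyiRate_one_sub_of_neg hα, IsPerronTilt, tiltedMatrix_one_sub]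
    using exists_objective_eq_renyiRate_of_one_lt (α := 1 - α) (by linarith) θ ν

theorem renyiRate_eq_iSup_of_neg (hα : α < 0) (ν θ : MarkovDist S) :
    renyiRate α ν θ = ⨆ (μ : MarkovDist S) (_ : μ.AbsCont θ), objective α ν θ μ := by
  simpa only [objective_one_sub, renyiRate_one_sub_of_neg hα]
    using renyiRate_eq_iSup_of_one_lt (α := 1 - α) (by linarith) θ ν

end Variational

end MarkovDist

theorem mainTheorem3 {S : Type*} [Fintype S] (α : ℝ) (hα0 : α ≠ 0) (hα1 : α ≠ 1)
    (ν θ : MarkovDist S) :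
    Tendsto (MarkovDist.renyiPerStep α ν θ) atTop (𝓝 (MarkovDist.renyiRate α ν θ)) ∧
    (1 < α →
      MarkovDist.renyiRate α ν θ =
        (⨆ (μ : MarkovDist S) (_ : μ.AbsCont ν), MarkovDist.objective α ν θ μ) ∧
      ∃ μ : MarkovDist S, μ.AbsCont ν ∧
        MarkovDist.objective α ν θ μ = MarkovDist.renyiRate α ν θ ∧
        (ν.AbsCont θ → MarkovDist.IsPerronTilt α ν θ μ)) ∧
    (0 < α → α < 1 →
      MarkovDist.renyiRate α ν θ =
        (⨅ (μ : MarkovDist S) (_ : μ.AbsCont ν ∧ μ.AbsCont θ), MarkovDist.objective α ν θ μ) ∧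
      ((∃ μ : MarkovDist S, μ.AbsCont ν ∧ μ.AbsCont θ) →
        ∃ μ : MarkovDist S, (μ.AbsCont ν ∧ μ.AbsCont θ) ∧
          MarkovDist.objective α ν θ μ = MarkovDist.renyiRate α ν θ ∧
          MarkovDist.IsPerronTilt α ν θ μ)) ∧
    (α < 0 →
      MarkovDist.renyiRate α ν θ =
        (⨆ (μ : MarkovDist S) (_ : μ.AbsCont θ), MarkovDist.objective α ν θ μ) ∧
      ∃ μ : MarkovDist S, μ.AbsCont θ ∧
        MarkovDist.objective α ν θ μ = MarkovDist.renyiRate α ν θ ∧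
        (θ.AbsCont ν → MarkovDist.IsPerronTilt α ν θ μ)) := by
  exact ⟨MarkovDist.tendsto_renyiPerStep_renyiRate hα0 hα1 ν θ,
    fun hα => ⟨MarkovDist.renyiRate_eq_iSup_of_one_lt hα ν θ,
      MarkovDist.exists_objective_eq_renyiRate_of_one_lt hα ν θ⟩,
    fun hα hα' => ⟨MarkovDist.renyiRate_eq_iInf_of_lt_one hα hα' ν θ,
      MarkovDist.exists_isPerronTilt_objective_eq_renyiRate hα hα1 (absurd · hα'.not_gt)⟩,
    fun hα => ⟨MarkovDist.renyiRate_eq_iSup_of_neg hα ν θ,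
      MarkovDist.exists_objective_eq_renyiRate_of_neg hα ν θ⟩⟩
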